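/- Let $m,n,d$ be positive integers with $d\ge m+n+\min\{m,n\}$, and let $\ell:\mathbb{R}^{m\times n}\to\mathbb{R}$ be locally Lipschitz. Define $$\mathcal{H}:\mathbb{R}^{d\times m}\times\mathbb{R}^{d\times n}\to\mathbb{R}^{m\times n},\quad \mathcal{H}(X,Y):=X^{\mathrm T}Y,\qquad f:=\ell\circ\mathcal{H},\quad\text{i.e. } f(X,Y)=\ell(X^{\mathrm T}Y),$$ where all matrix spaces carry the Frobenius inner product and $\mathbb{R}^{d\times m}\times\mathbb{R}^{d\times n}$ carries the sum of the two inner products. For a locally Lipschitz function $g$ on a finite-dimensional Euclidean space and a point $x$, let $\partial_C g(x)$ denote the Clarke subdifferential $$\partial_C g(x):=\operatorname{conv}\Big\{\lim_{k\to\infty}\nabla g(x_k)\;:\;x_k\to x,\ g\text{ differentiable at every }x_k,\ (\nabla g(x_k))_k\text{ converges}\Big\}.$$ Then the Clarke chain rule for $f$ holds as an equality at every point: for all $(X,Y)\in\mathbb{R}^{d\times m}\times\mathbb{R}^{d\times n}$, $$\partial_C f(X,Y)=J_{\mathcal{H}}(X,Y)^{\mathrm T}\,\partial_C\ell(X^{\mathrm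 T}Y):=\big\{J_{\mathcal{H}}(X,Y)^{\mathrm T}S\;:\;S\in\partial_C\ell(X^{\mathrm T}Y)\big\},$$ where $J_{\mathcal{H}}(X,Y)^{\mathrm T}$ is the transpose of the Jacobian of $\mathcal{H}$ at $(X,Y)$, that is, the adjoint of its derivative. -/

import Mathlib

open Filter Topology

noncomputable section

section Clarke

variable {E : Type*} [NormedAddCommGroup E] [InnerProductSpace ℝ E] [CompleteSpace E]

/-- The set `limsup_{y → x, y ∈ D} {∇ f y}` (outer limit in the sense of Painlevé–Kuratowski), where
`D` is the set of points at which `f` is differentiable: all limits of gradients along sequences of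
points of differentiability that converge to `x`. -/
def limitingGradients (f : E → ℝ) (x : E) : Set E :=
  {s | ∃ y : ℕ → E, Tendsto y atTop (𝓝 x) ∧ (∀ k, DifferentiableAt ℝ f (y k)) ∧
    Tendsto (fun k => gradient f (y k)) atTop (𝓝 s)}

/-- The Clarke subdifferential of a (locally Lipschitz) function `f` at `x`: the convex hull of the
set of limiting gradients. -/
def clarkeSubdifferential (f : E → ℝ) (x : E) : Set E :=
  convexHull ℝ (limitingGradients f x)

end Clarke

/-- The Euclidean space of real `p × q` matrices: inner product `⟪A, B⟫ = ∑ i j, A i j * B i j`,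
whose norm is the Frobenius norm. -/
abbrev MatrixSpace (p q : ℕ) : Type := EuclideanSpace ℝ (Fin p × Fin q)

namespace MatrixSpace

/-- The matrix with the given entries. -/
def toMatrix {p q : ℕ} (A : MatrixSpace p q) : Matrix (Fin p) (Fin q) ℝ :=
  Matrix.of fun i j => A (i, j)

/-- A matrix as a point of the Euclidean space of matrices. -/
def ofMatrix {p q : ℕ} (A : Matrix (Fin p) (Fin q) ℝ) : MatrixSpace p q :=
  WithLp.toLp 2 fun ij => A ij.1 ij.2

end MatrixSpace

/-- The Euclidean space `ℝ^{d × m} × ℝ^{d × n}` of pairs of factors `(X, Y)`, with inner product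
`⟪(X, Y), (X', Y')⟫ = ⟪X, X'⟫ + ⟪Y, Y'⟫`. -/
abbrev FactorSpace (d m n : ℕ) : Type := WithLp 2 (MatrixSpace d m × MatrixSpace d n)

/-- The matrix factorization map `(X, Y) ↦ Xᵀ Y` from `ℝ^{d × m} × ℝ^{d × n}` to `ℝ^{m × n}`. -/
def matrixFactorizationMap (d m n : ℕ) (P : FactorSpace d m n) : MatrixSpace m n :=
  MatrixSpace.ofMatrix ((MatrixSpace.toMatrix P.fst).transpose * MatrixSpace.toMatrix P.snd)

/-- The transposed Jacobian `J_H(x)ᵀ` of a differentiable map `H` at `x`, as a linear map: the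
adjoint of the derivative of `H` at `x`. -/
def jacobianTranspose {E F : Type*} [NormedAddCommGroup E] [InnerProductSpace ℝ E]
    [CompleteSpace E] [NormedAddCommGroup F] [InnerProductSpace ℝ F] [CompleteSpace F]
    (H : E → F) (x : E) : F →L[ℝ] E :=
  ContinuousLinearMap.adjoint (fderiv ℝ H x)

end

/-! The inclusion `⊆` is Clarke's chain rule, valid for every `C¹` inner map `H`. A point outside
the compact convex right-hand side is separated by a vector `v`, and the derivative of `ℓ ∘ H` along
`v` is bounded through gradients of `ℓ` nearby. Since `ℓ` need not be differentiable at `H y`, the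
bound uses a mean value inequality that sees only differentiability points
(`fderiv_comp_le_of_fderiv_le`).

For `⊇`, points `z_k → Xᵀ Y` where `ℓ` is differentiable must lift to points `x_k → (X, Y)` with `H
x_k = z_k`; the smooth chain rule then transports the gradients. Take `U` with `min m n` orthonormal
columns orthogonal to those of `X` and `Y`, which is where the bound on `d` enters. Then `(X + U A)ᵀ
(Y + U B) = Xᵀ Y + Aᵀ B`, and `z_k - Xᵀ Y` factors as `Aᵀ B` with `A` and `B` both small. -/

open MeasureTheory in
/-- A one-sided mean value inequality for Lipschitz functions. -/
theorem LipschitzWith.sub_le_of_fderiv_le {E : Type*} [NormedAddCommGroup E] [NormedSpace ℝ E]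
    [FiniteDimensional ℝ E] {g : E → ℝ} {K : NNReal} (hg : LipschitzWith K g) {U : Set E}
    (hU : IsOpen U) (hUc : Convex ℝ U) {b w : E} {c : ℝ} (hb : b ∈ U) (hbw : b + w ∈ U)
    (h : ∀ y ∈ U, DifferentiableAt ℝ g y → fderiv ℝ g y w ≤ c) : g (b + w) - g b ≤ c := by
  by_contra! hlt
  obtain ⟨c', hc, hc'⟩ := exists_between hlt
  let _ : MeasurableSpace E := borel E
  have _ : BorelSpace E := ⟨rfl⟩
  set μ : Measure E := Measure.addHaar
  have hcont := hg.continuous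
  have h1 : ∀ᶠ z in 𝓝 (0 : E), c' < g (b + w + z) - g (b + z) := by
    have : ContinuousAt (fun z => g (b + w + z) - g (b + z)) 0 := by fun_prop
    exact this.eventually (lt_mem_nhds (by simpa using hc'))
  have h2 : ∀ᶠ z in 𝓝 (0 : E), b + z ∈ U := by
    have : ContinuousAt (fun z => b + z) 0 := by fun_prop
    exact this.eventually (hU.mem_nhds (by simpa using hb))
  have h3 : ∀ᶠ z in 𝓝 (0 : E), b + w + z ∈ U := by
    have : ContinuousAt (fun z => b + w + z) 0 := by fun_prop
    exact this.eventually (hU.mem_nhds (by simpa using hbw))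
  obtain ⟨ε, hε, hball⟩ := Metric.eventually_nhds_iff_ball.1 (h1.and (h2.and h3))
  -- The segment from `b` to `b + w` may miss every differentiability point, so it is averaged over
  -- translates in `B`: by Rademacher, at each time almost every translate is good. The gap `c < c'`
  -- survives averaging.
  set B := Metric.ball (0 : E) ε
  have hBm : MeasurableSet B := measurableSet_ball
  have hBfin : μ B < ⊤ := measure_ball_lt_top
  have hBpos : 0 < μ.real B :=
    ENNReal.toReal_pos (Metric.measure_ball_pos μ 0 hε).ne' hBfin.ne
  have hint : ∀ a : E, IntegrableOn (fun z => g (a + z)) B μ := by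
    intro a
    have : Continuous fun z => g (a + z) := by fun_prop
    exact (this.continuousOn.integrableOn_compact (isCompact_closedBall (0 : E) ε)).mono_set
      Metric.ball_subset_closedBall
  have hae : ∀ a : E, ∀ᵐ z ∂μ, DifferentiableAt ℝ g (a + z) := fun a =>
    (measurePreserving_add_left μ a).quasiMeasurePreserving.ae hg.ae_differentiableAt
  have hderiv : ∀ t : ℝ, IntegrableOn (fun z => fderiv ℝ g (b + t • w + z) w) B μ ∧
      HasDerivAt (fun t : ℝ => ∫ z in B, g (b + t • w + z) ∂μ)
      (∫ z in B, fderiv ℝ g (b + t • w + z) w ∂μ) t := by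
    intro t
    refine hasDerivAt_integral_of_dominated_loc_of_lip (bound := fun _ => K * ‖w‖)
      (s := Set.univ) univ_mem ?_ (hint _) ?_ ?_ ?_ ?_
    · exact .of_forall fun x => (hint _).aestronglyMeasurable
    · have : Measurable fun z => fderiv ℝ g (b + t • w + z) w :=
        (measurable_fderiv_apply_const ℝ g w).comp (measurable_const_add _)
      exact this.aestronglyMeasurable
    · refine .of_forall fun z => LipschitzWith.lipschitzOnWith ?_
      refine LipschitzWith.of_dist_le_mul fun s s' => ?_
      refine (hg.dist_le_mul _ _).trans (le_of_eq ?_)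
      rw [dist_add_right, dist_add_left, dist_eq_norm, ← sub_smul, norm_smul, Real.dist_eq,
        Real.norm_eq_abs, Real.coe_nnabs, abs_of_nonneg (show (0 : ℝ) ≤ K * ‖w‖ by positivity)]
      ring
    · exact integrableOn_const hBfin.ne
    · refine ae_restrict_of_ae ((hae (b + t • w)).mono fun z hz => ?_)
      have h4 : HasDerivAt (fun t : ℝ => b + t • w + z) w t := by
        simpa using (((hasDerivAt_id t).smul_const w).const_add b).add_const z
      exact hz.hasFDerivAt.comp_hasDerivAt t h4
  have hle : ∀ t ∈ Set.Icc (0 : ℝ) 1,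
      ∫ z in B, fderiv ℝ g (b + t • w + z) w ∂μ ≤ c * μ.real B := by
    intro t ht
    have : ∫ z in B, fderiv ℝ g (b + t • w + z) w ∂μ ≤ ∫ z in B, c ∂μ := by
      refine setIntegral_mono_on_ae (hderiv t).1 (integrableOn_const hBfin.ne) hBm ?_
      refine (hae (b + t • w)).mono fun z hz hzB => h _ ?_ hz
      have := hUc.add_smul_sub_mem (hball z hzB).2.1 (hball z hzB).2.2 ht
      convert this using 1
      rw [add_right_comm b w z, add_sub_cancel_left]
      abel
    simpa [mul_comm] using this
  have hmv := Convex.image_sub_le_mul_sub_of_deriv_le (convex_Icc (0 : ℝ) 1)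
    (f := fun t : ℝ => ∫ z in B, g (b + t • w + z) ∂μ) (C := c * μ.real B)
    (fun t _ => (hderiv t).2.continuousAt.continuousWithinAt)
    (fun t _ => (hderiv t).2.differentiableAt.differentiableWithinAt)
    (fun t ht => (hderiv t).2.deriv ▸ hle t (interior_subset ht))
    0 (by simp) 1 (by simp) zero_le_one
  simp only [one_smul, zero_smul, add_zero, sub_zero, mul_one] at hmv
  rw [← integral_sub (hint _) (hint _)] at hmv
  have hge : ∫ z in B, c' ∂μ ≤ ∫ z in B, (g (b + w + z) - g (b + z)) ∂μ :=
    setIntegral_mono_on (integrableOn_const hBfin.ne) ((hint _).sub (hint _)) hBm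
      fun z hz => (hball z hz).1.le
  have : c' * μ.real B ≤ c * μ.real B := by
    refine le_trans (le_of_eq ?_) (hge.trans hmv)
    simp [mul_comm]
  exact absurd (le_of_mul_le_mul_right this hBpos) (not_le.2 hc)

/-- The convex hull of a compact set in a finite-dimensional space is compact. -/
theorem IsCompact.convexHull_of_finiteDimensional {E : Type*} [NormedAddCommGroup E]
    [NormedSpace ℝ E] [FiniteDimensional ℝ E] {s : Set E} (hs : IsCompact s) :
    IsCompact (convexHull ℝ s) := by
  -- Carathéodory: at most `finrank + 1` points suffice.
  have key : convexHull ℝ s = ⋃ k ∈ Finset.range (Module.finrank ℝ E + 2),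
      (fun p : (Fin k → ℝ) × (Fin k → E) => ∑ i, p.1 i • p.2 i) ''
        (stdSimplex ℝ (Fin k) ×ˢ Set.univ.pi fun _ => s) := by
    refine Set.Subset.antisymm (fun x hx => ?_) (Set.iUnion₂_subset fun k _ => ?_)
    · obtain ⟨ι, _, z, w, hz, hind, hw, hw1, rfl⟩ := eq_pos_convex_span_of_mem_convexHull hx
      have hcard := hind.card_le_finrank_succ
      have hfin := Submodule.finrank_le (vectorSpan ℝ (Set.range z))
      let e := (Fintype.equivFin ι).symm
      refine Set.mem_iUnion₂.2 ⟨Fintype.card ι, by simp; omega, (w ∘ e, z ∘ e),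
        ⟨⟨fun i => (hw _).le, ?_⟩, fun i _ => hz ⟨_, rfl⟩⟩, ?_⟩
      · simpa [Function.comp_def] using (e.sum_comp w).trans hw1
      · exact e.sum_comp fun i => w i • z i
    · rintro _ ⟨p, ⟨hp1, hp2⟩, rfl⟩
      exact (convex_convexHull ℝ s).sum_mem (fun i _ => hp1.1 i) hp1.2
        fun i _ => subset_convexHull ℝ s (hp2 i trivial)
  rw [key]
  refine Finset.isCompact_biUnion _ fun k _ => ?_
  exact ((isCompact_stdSimplex ℝ (Fin k)).prod (isCompact_univ_pi fun _ => hs)).image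
    (by fun_prop)

/-- A global Lipschitz extension has the same derivatives on the open set `U`. -/
theorem LipschitzOnWith.sub_le_of_fderiv_le {E : Type*} [NormedAddCommGroup E] [NormedSpace ℝ E]
    [FiniteDimensional ℝ E] {g : E → ℝ} {K : NNReal} {U : Set E} (hg : LipschitzOnWith K g U)
    (hU : IsOpen U) (hUc : Convex ℝ U) {b w : E} {c : ℝ} (hb : b ∈ U) (hbw : b + w ∈ U)
    (h : ∀ y ∈ U, DifferentiableAt ℝ g y → fderiv ℝ g y w ≤ c) : g (b + w) - g b ≤ c := by
  obtain ⟨g', hg', heq⟩ := hg.extend_real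
  rw [heq hb, heq hbw]
  refine hg'.sub_le_of_fderiv_le hU hUc hb hbw fun y hy hd => ?_
  have hev : g =ᶠ[𝓝 y] g' := heq.eventuallyEq_of_mem (hU.mem_nhds hy)
  rw [← hev.fderiv_eq]
  exact h y hy (hev.differentiableAt_iff.2 hd)

/-! ### Limiting gradients: compactness and semicontinuity -/

section

variable {E : Type*} [NormedAddCommGroup E] [InnerProductSpace ℝ E] [CompleteSpace E]

theorem inner_gradient_eq_fderiv (f : E → ℝ) (x v : E) :
    inner ℝ (gradient f x) v = fderiv ℝ f x v := by
  simp [gradient]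

theorem norm_gradient (f : E → ℝ) (x : E) : ‖gradient f x‖ = ‖fderiv ℝ f x‖ := by
  simp [gradient]

theorem mem_limitingGradients_iff_mapClusterPt {f : E → ℝ} {x s : E} :
    s ∈ limitingGradients f x ↔
      MapClusterPt s (𝓝 x ⊓ 𝓟 {y | DifferentiableAt ℝ f y}) (gradient f) := by
  constructor
  · rintro ⟨y, hy, hd, hs⟩
    exact MapClusterPt.of_comp (tendsto_inf.2 ⟨hy, tendsto_principal.2 (.of_forall hd)⟩)
      hs.mapClusterPt
  · intro h
    have hne : NeBot (𝓝 x ⊓ 𝓟 {y | DifferentiableAt ℝ f y} ⊓ comap (gradient f) (𝓝 s)) := by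
      rw [neBot_inf_comap_iff_map, inf_comm]
      exact h
    obtain ⟨y, hy⟩ := exists_seq_tendsto
      (𝓝 x ⊓ 𝓟 {y | DifferentiableAt ℝ f y} ⊓ comap (gradient f) (𝓝 s))
    obtain ⟨h1, h2⟩ := tendsto_inf.1 hy
    obtain ⟨h1, h3⟩ := tendsto_inf.1 h1
    obtain ⟨N, hN⟩ := eventually_atTop.1 (tendsto_principal.1 h3)
    exact ⟨fun k => y (k + N), h1.comp (tendsto_add_atTop_nat N), fun k => hN _ (by omega),
      (tendsto_comap_iff.1 h2).comp (tendsto_add_atTop_nat N)⟩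

theorem isClosed_limitingGradients (f : E → ℝ) (x : E) : IsClosed (limitingGradients f x) := by
  have : limitingGradients f x = {s | MapClusterPt s _ (gradient f)} :=
    Set.ext fun s => mem_limitingGradients_iff_mapClusterPt
  rw [this]
  exact isClosed_setOfPred_clusterPt

theorem LocallyLipschitz.eventually_norm_gradient_le {f : E → ℝ} (hf : LocallyLipschitz f)
    (x : E) : ∃ K : NNReal, ∀ᶠ y in 𝓝 x, ‖gradient f y‖ ≤ K := by
  obtain ⟨K, t, ht, hK⟩ := hf x
  refine ⟨K, (eventually_eventually_nhds.2 ht).mono fun y hy => ?_⟩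
  rw [norm_gradient]
  exact norm_fderiv_le_of_lipschitzOn ℝ hy hK

variable [FiniteDimensional ℝ E]

theorem LocallyLipschitz.isCompact_limitingGradients {f : E → ℝ} (hf : LocallyLipschitz f)
    (x : E) : IsCompact (limitingGradients f x) := by
  obtain ⟨K, hK⟩ := hf.eventually_norm_gradient_le x
  refine (isCompact_closedBall (0 : E) K).of_isClosed_subset (isClosed_limitingGradients f x) ?_
  rintro s ⟨y, hy, -, hs⟩
  rw [mem_closedBall_zero_iff]
  exact le_of_tendsto hs.norm (hy.eventually hK)

theorem LocallyLipschitz.isCompact_clarkeSubdifferential {f : E → ℝ} (hf : LocallyLipschitz f)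
    (x : E) : IsCompact (clarkeSubdifferential f x) :=
  (hf.isCompact_limitingGradients x).convexHull_of_finiteDimensional

/-- Upper semicontinuity of the limiting gradients in a fixed direction. -/
theorem LocallyLipschitz.eventually_fderiv_le {f : E → ℝ} (hf : LocallyLipschitz f) {x w : E}
    {c : ℝ} (hc : ∀ s ∈ limitingGradients f x, inner ℝ s w < c) :
    ∀ᶠ y in 𝓝 x, DifferentiableAt ℝ f y → fderiv ℝ f y w ≤ c := by
  obtain ⟨K, hK⟩ := hf.eventually_norm_gradient_le x
  by_contra hcon
  -- Along points violating the bound, the bounded gradients cluster at a limiting gradient `s` with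
  -- `c ≤ ⟪s, w⟫`.
  set G : Filter E := 𝓝 x ⊓ 𝓟 {y | DifferentiableAt ℝ f y ∧ c < fderiv ℝ f y w}
  have hG : NeBot G := by
    rw [← frequently_mem_iff_neBot]
    simpa only [not_eventually, Classical.not_imp, not_le, Set.mem_ofPred_eq] using hcon
  have hball : map (gradient f) G ≤ 𝓟 (Metric.closedBall 0 K) := by
    rw [le_principal_iff, mem_map]
    exact mem_inf_of_left (hK.mono fun y hy => by simpa using hy)
  obtain ⟨s, -, hs⟩ := (isCompact_closedBall (0 : E) K) hball
  have hs' : s ∈ limitingGradients f x :=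
    mem_limitingGradients_iff_mapClusterPt.2 (MapClusterPt.mono (F := G) hs
      (inf_le_inf_left _ (principal_mono.2 fun y hy => hy.1)))
  have hcl : IsClosed {s : E | c ≤ inner ℝ s w} :=
    isClosed_le continuous_const (by fun_prop)
  have : s ∈ {s : E | c ≤ inner ℝ s w} := by
    refine hcl.mem_of_mapClusterPt (MapClusterPt.mono (F := G) hs le_rfl) ?_
    refine mem_inf_of_right fun y hy => ?_
    simpa only [Set.mem_ofPred_eq, inner_gradient_eq_fderiv] using hy.2.le
  exact absurd (hc s hs') (not_lt.2 this)

end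

/-! ### Chain rule inclusions -/

theorem tendsto_clm_apply {ι E F : Type*} [NormedAddCommGroup E] [NormedSpace ℝ E]
    [NormedAddCommGroup F] [NormedSpace ℝ F] {l : Filter ι} {A : ι → E →L[ℝ] F} {u : ι → E}
    {A₀ : E →L[ℝ] F} {u₀ : E} (hA : Tendsto A l (𝓝 A₀)) (hu : Tendsto u l (𝓝 u₀)) :
    Tendsto (fun k => A k (u k)) l (𝓝 (A₀ u₀)) :=
  (isBoundedBilinearMap_apply.continuous.tendsto (A₀, u₀)).comp (hA.prodMk_nhds hu)

/-- Because `ℓ` is Lipschitz near `H x`, replacing the curve `H (x + t v)` by its tangent line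
changes `ℓ` by `o(t)`. Along the line the mean value inequality bounds the difference quotients for
`t > 0`. -/
theorem fderiv_comp_le_of_fderiv_le {E F : Type*} [NormedAddCommGroup E] [NormedSpace ℝ E]
    [NormedAddCommGroup F] [NormedSpace ℝ F] [FiniteDimensional ℝ F] {H : E → F} {ℓ : F → ℝ}
    {K : NNReal} {U : Set F} (hℓ : LipschitzOnWith K ℓ U) (hU : IsOpen U) (hUc : Convex ℝ U) {x v : E} {c : ℝ}
    (hx : H x ∈ U) (hH : DifferentiableAt ℝ H x) (hd : DifferentiableAt ℝ (fun y => ℓ (H y)) x)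
    (h : ∀ z ∈ U, DifferentiableAt ℝ ℓ z → fderiv ℝ ℓ z (fderiv ℝ H x v) ≤ c) :
    fderiv ℝ (fun y => ℓ (H y)) x v ≤ c := by
  set w := fderiv ℝ H x v
  have hline : HasDerivAt (fun t : ℝ => x + t • v) v 0 := by
    simpa using ((hasDerivAt_id (0 : ℝ)).smul_const v).const_add x
  have hx0 : x + (0 : ℝ) • v = x := by simp
  have h1 : HasDerivAt (fun t : ℝ => ℓ (H (x + t • v))) (fderiv ℝ (fun y => ℓ (H y)) x v) 0 :=
    HasFDerivAt.comp_hasDerivAt (l := fun y => ℓ (H y)) 0 (by rw [hx0]; exact hd.hasFDerivAt) hline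
  have h2 : HasDerivAt (fun t : ℝ => H (x + t • v)) w 0 :=
    HasFDerivAt.comp_hasDerivAt (l := H) 0 (by rw [hx0]; exact hH.hasFDerivAt) hline
  have hw : HasDerivAt (fun t : ℝ => H x + t • w) w 0 := by
    simpa using ((hasDerivAt_id (0 : ℝ)).smul_const w).const_add (H x)
  have hU1 : ∀ᶠ t : ℝ in 𝓝 0, H (x + t • v) ∈ U :=
    h2.continuousAt.eventually (hU.mem_nhds (by simpa using hx))
  have hU2 : ∀ᶠ t : ℝ in 𝓝 0, H x + t • w ∈ U :=
    hw.continuousAt.eventually (hU.mem_nhds (by simpa using hx))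
  have h3 : HasDerivAt (fun t : ℝ => ℓ (H x + t • w) - ℓ (H (x + t • v))) 0 0 := by
    have h4 := hasDerivAt_iff_isLittleO.1 (hw.sub h2)
    refine hasDerivAt_iff_isLittleO.2 (Asymptotics.IsBigO.trans_isLittleO
      (Asymptotics.IsBigO.of_bound K ?_) h4)
    filter_upwards [hU1, hU2] with t ht1 ht2
    simpa using hℓ.norm_sub_le ht2 ht1
  have h5 : HasDerivAt (fun t : ℝ => ℓ (H x + t • w)) (fderiv ℝ (fun y => ℓ (H y)) x v) 0 := by
    simpa [Pi.add_def] using h3.add h1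
  refine le_of_tendsto (hasDerivAt_iff_tendsto_slope_zero.1 h5 |>.mono_left
    (nhdsWithin_mono 0 (s := Set.Ioi 0) fun t ht => (Set.mem_Ioi.1 ht).ne')) ?_
  filter_upwards [self_mem_nhdsWithin, mem_nhdsWithin_of_mem_nhds hU2] with t ht ht2
  have ht : 0 < t := ht
  have := hℓ.sub_le_of_fderiv_le hU hUc (c := t * c) hx ht2 fun z hz hdz => by
    rw [map_smul, smul_eq_mul]
    exact mul_le_mul_of_nonneg_left (h z hz hdz) ht.le
  simp only [zero_add, zero_smul, add_zero, smul_eq_mul]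
  rwa [inv_mul_le_iff₀ ht]

section ChainRule

variable {E F : Type*} [NormedAddCommGroup E] [InnerProductSpace ℝ E] [CompleteSpace E]
  [NormedAddCommGroup F] [InnerProductSpace ℝ F] [CompleteSpace F]

theorem gradient_comp_eq_jacobianTranspose {H : E → F} {ℓ : F → ℝ} {x : E}
    (hH : DifferentiableAt ℝ H x) (hℓ : DifferentiableAt ℝ ℓ (H x)) :
    gradient (fun y => ℓ (H y)) x = jacobianTranspose H x (gradient ℓ (H x)) := by
  refine ext_inner_right ℝ fun v => ?_
  rw [jacobianTranspose, ContinuousLinearMap.adjoint_inner_left, inner_gradient_eq_fderiv,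
    inner_gradient_eq_fderiv, fderiv_fun_comp x hℓ hH]
  rfl

theorem continuous_jacobianTranspose {H : E → F} (hH : ContDiff ℝ 1 H) :
    Continuous (jacobianTranspose H) :=
  ContinuousLinearMap.adjoint.continuous.comp (hH.continuous_fderiv one_ne_zero)

/-- The chain rule inclusion that holds when `H` has a right inverse that is continuous at
`H x` and maps `H x` to `x`. -/
theorem image_clarkeSubdifferential_subset {H : E → F} (hH : ContDiff ℝ 1 H) (ℓ : F → ℝ) {x : E}
    {φ : F → E} (hφ : ∀ z, H (φ z) = z) (hlim : Tendsto φ (𝓝 (H x)) (𝓝 x)) :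
    jacobianTranspose H x '' clarkeSubdifferential ℓ (H x) ⊆
      clarkeSubdifferential (fun y => ℓ (H y)) x := by
  have hdiff : Differentiable ℝ H := hH.differentiable one_ne_zero
  rw [clarkeSubdifferential, ← ContinuousLinearMap.coe_coe, LinearMap.image_convexHull]
  refine convexHull_mono ?_
  rintro _ ⟨s, ⟨z, hz, hd, hs⟩, rfl⟩
  have hd' : ∀ k, DifferentiableAt ℝ ℓ (H (φ (z k))) := fun k => (hφ (z k)).symm ▸ hd k
  have hx : Tendsto (fun k => φ (z k)) atTop (𝓝 x) := hlim.comp hz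
  refine ⟨fun k => φ (z k), hx, fun k => DifferentiableAt.comp (g := ℓ) _ (hd' k) (hdiff _), ?_⟩
  simp only [gradient_comp_eq_jacobianTranspose (hdiff _) (hd' _), hφ]
  exact tendsto_clm_apply (((continuous_jacobianTranspose hH).tendsto x).comp hx) hs

/-- Clarke's chain rule inclusion. -/
theorem clarkeSubdifferential_comp_subset [FiniteDimensional ℝ F] {H : E → F}
    (hH : ContDiff ℝ 1 H) {ℓ : F → ℝ} (hℓ : LocallyLipschitz ℓ) (x : E) :
    clarkeSubdifferential (fun y => ℓ (H y)) x ⊆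
      jacobianTranspose H x '' clarkeSubdifferential ℓ (H x) := by
  have hconv : Convex ℝ (jacobianTranspose H x '' clarkeSubdifferential ℓ (H x)) :=
    (convex_convexHull ℝ _).linear_image (jacobianTranspose H x).toLinearMap
  have hclosed : IsClosed (jacobianTranspose H x '' clarkeSubdifferential ℓ (H x)) :=
    ((hℓ.isCompact_clarkeSubdifferential _).image (jacobianTranspose H x).continuous).isClosed
  refine convexHull_min ?_ hconv
  rintro s ⟨y, hy, hd, hs⟩
  by_contra hcon
  obtain ⟨L, c, hLc, hcs⟩ := geometric_hahn_banach_closed_point hconv hclosed hcon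
  set v := (InnerProductSpace.toDual ℝ E).symm L
  have hL : ∀ z, L z = inner ℝ z v := fun z => by
    rw [real_inner_comm]; simp [v]
  set w := fderiv ℝ H x v
  have hlim : ∀ S ∈ limitingGradients ℓ (H x), inner ℝ S w < c := fun S hS => by
    have := hLc _ (Set.mem_image_of_mem _ (subset_convexHull ℝ _ hS))
    rwa [hL, jacobianTranspose, ContinuousLinearMap.adjoint_inner_left] at this
  obtain ⟨K, t, ht, hK⟩ := hℓ (H x)
  obtain ⟨r, hr, hball⟩ := Metric.eventually_nhds_iff_ball.1
    ((hℓ.eventually_fderiv_le hlim).and (eventually_eventually_nhds.2 ht))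
  have hKball : LipschitzOnWith K ℓ (Metric.ball (H x) r) :=
    hK.mono fun z hz => mem_of_mem_nhds (hball z hz).2
  -- The semicontinuity bound concerns the fixed direction `w`; the Lipschitz constant pays for the
  -- actual direction `fderiv ℝ H (y k) v`, and this error vanishes in the limit.
  have hbound : ∀ᶠ k in atTop,
      inner ℝ (gradient (fun y => ℓ (H y)) (y k)) v ≤ c + K * ‖fderiv ℝ H (y k) v - w‖ := by
    have : ∀ᶠ k in atTop, H (y k) ∈ Metric.ball (H x) r :=
      (hH.continuous.continuousAt.tendsto.comp hy).eventually (Metric.ball_mem_nhds _ hr)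
    filter_upwards [this] with k hk
    rw [inner_gradient_eq_fderiv]
    refine fderiv_comp_le_of_fderiv_le hKball Metric.isOpen_ball (convex_ball _ _) hk
      (hH.differentiable one_ne_zero _) (hd k) fun z hz hdz => ?_
    have h1 := (hball z hz).1 hdz
    have h2 : fderiv ℝ ℓ z (fderiv ℝ H (y k) v - w) ≤ K * ‖fderiv ℝ H (y k) v - w‖ :=
      (le_abs_self _).trans ((fderiv ℝ ℓ z).le_of_opNorm_le
        (norm_fderiv_le_of_lipschitzOn ℝ (hball z hz).2 hK) _)
    rw [map_sub] at h2
    linarith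
  have hlim1 : Tendsto (fun k => inner ℝ (gradient (fun y => ℓ (H y)) (y k)) v) atTop
      (𝓝 (inner ℝ s v)) := hs.inner tendsto_const_nhds
  have hlim2 : Tendsto (fun k => c + K * ‖fderiv ℝ H (y k) v - w‖) atTop
      (𝓝 (c + K * ‖w - w‖)) := by
    have : Tendsto (fun k => fderiv ℝ H (y k) v) atTop (𝓝 w) :=
      tendsto_clm_apply (((hH.continuous_fderiv one_ne_zero).tendsto x).comp hy)
        tendsto_const_nhds
    exact ((this.sub_const w).norm.const_mul _).const_add c
  have := le_of_tendsto_of_tendsto hlim1 hlim2 hbound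
  rw [sub_self, norm_zero, mul_zero, add_zero, ← hL] at this
  exact absurd hcs (not_lt.2 this)

end ChainRule

/-! ### Lifting through the matrix factorization map -/

theorem contDiff_matrixFactorizationMap (d m n : ℕ) :
    ContDiff ℝ 1 (matrixFactorizationMap d m n) := by
  refine contDiff_euclidean.2 fun ij => ?_
  simp only [matrixFactorizationMap, MatrixSpace.ofMatrix, MatrixSpace.toMatrix,
    Matrix.mul_apply, Matrix.transpose_apply, Matrix.of_apply]
  have hX : ContDiff ℝ 1 fun P : FactorSpace d m n => P.fst :=
    (WithLp.fstL 2 ℝ (MatrixSpace d m) (MatrixSpace d n)).contDiff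
  have hY : ContDiff ℝ 1 fun P : FactorSpace d m n => P.snd :=
    (WithLp.sndL 2 ℝ (MatrixSpace d m) (MatrixSpace d n)).contDiff
  exact ContDiff.sum fun k _ =>
    (contDiff_euclidean.1 hX (k, ij.1)).mul (contDiff_euclidean.1 hY (k, ij.2))

theorem real_inner_eq_sum_mul {ι : Type*} [Fintype ι] (x y : EuclideanSpace ℝ ι) :
    inner ℝ x y = ∑ k, x k * y k := by
  simp [PiLp.inner_apply, mul_comm]

/-- Orthonormal columns orthogonal to all columns of two given matrices. -/
theorem exists_orthonormal_columns_orthogonal {d m n r : ℕ} (hd : m + n + r ≤ d)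
    (X : Matrix (Fin d) (Fin m) ℝ) (Y : Matrix (Fin d) (Fin n) ℝ) :
    ∃ U : Matrix (Fin d) (Fin r) ℝ,
      U.transpose * U = 1 ∧ X.transpose * U = 0 ∧ Y.transpose * U = 0 := by
  let col : Fin m ⊕ Fin n → EuclideanSpace ℝ (Fin d) :=
    Sum.elim (fun i => WithLp.toLp 2 fun k => X k i) fun j => WithLp.toLp 2 fun k => Y k j
  let W := Submodule.span ℝ (Set.range col)
  have hW : Module.finrank ℝ W ≤ m + n := by
    simpa [Set.finrank] using finrank_range_le_card (R := ℝ) col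
  have hsum := W.finrank_add_finrank_orthogonal
  rw [finrank_euclideanSpace_fin] at hsum
  have hr : r ≤ Module.finrank ℝ Wᗮ := by omega
  let u : Fin r → Wᗮ := fun i => stdOrthonormalBasis ℝ Wᗮ (Fin.castLE hr i)
  have hu : Orthonormal ℝ u :=
    (stdOrthonormalBasis ℝ Wᗮ).orthonormal.comp _ (Fin.castLE_injective hr)
  have horth : ∀ a j, inner ℝ (col a) (u j : EuclideanSpace ℝ (Fin d)) = 0 := fun a j =>
    (Submodule.mem_orthogonal _ _).1 (u j).2 _ (Submodule.subset_span ⟨a, rfl⟩)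
  refine ⟨Matrix.of fun k j => (u j : EuclideanSpace ℝ (Fin d)) k, ?_, ?_, ?_⟩
  · ext i j
    rw [Matrix.one_apply, ← orthonormal_iff_ite.1 hu i j, Submodule.coe_inner,
      real_inner_eq_sum_mul]
    rfl
  · ext i j
    rw [Matrix.zero_apply, ← horth (.inl i) j, real_inner_eq_sum_mul]
    rfl
  · ext i j
    rw [Matrix.zero_apply, ← horth (.inr i) j, real_inner_eq_sum_mul]
    rfl

theorem tendsto_inv_sqrt_norm_smul_toMatrix (m n : ℕ) :
    Tendsto (fun D : MatrixSpace m n => (√‖D‖)⁻¹ • D.toMatrix) (𝓝 0) (𝓝 0) := by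
  have hsqrt : Tendsto (fun D : MatrixSpace m n => √‖D‖) (𝓝 0) (𝓝 0) := by
    have : Continuous fun D : MatrixSpace m n => √‖D‖ := by fun_prop
    simpa using this.tendsto 0
  refine tendsto_pi_nhds.2 fun i => tendsto_pi_nhds.2 fun j => ?_
  refine squeeze_zero_norm (fun D => ?_) hsqrt
  have h1 : ‖D (i, j)‖ ≤ ‖D‖ := PiLp.norm_apply_le D (i, j)
  simp only [MatrixSpace.toMatrix, Matrix.smul_apply, Matrix.of_apply, smul_eq_mul, norm_mul,
    norm_inv, Real.norm_of_nonneg (Real.sqrt_nonneg _)]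
  calc (√‖D‖)⁻¹ * ‖D (i, j)‖ ≤ (√‖D‖)⁻¹ * ‖D‖ := by gcongr
    _ = √‖D‖ := by rw [inv_mul_eq_div, Real.div_sqrt]

theorem tendsto_sqrt_norm_smul_one (m n r : ℕ) :
    Tendsto (fun D : MatrixSpace m n => √‖D‖ • (1 : Matrix (Fin r) (Fin r) ℝ)) (𝓝 0) (𝓝 0) := by
  have : Continuous fun D : MatrixSpace m n => √‖D‖ • (1 : Matrix (Fin r) (Fin r) ℝ) := by
    fun_prop
  simpa using this.tendsto 0

/-- At `D = 0` the scalar is `0`, harmlessly, since the matrix vanishes too. -/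
theorem sqrt_norm_mul_inv_smul_toMatrix {m n : ℕ} (D : MatrixSpace m n) :
    (√‖D‖ * (√‖D‖)⁻¹) • D.toMatrix = D.toMatrix := by
  rcases eq_or_ne D 0 with rfl | hD
  · ext i j
    simp [MatrixSpace.toMatrix]
  · rw [mul_inv_cancel₀ (Real.sqrt_ne_zero'.2 (norm_pos_iff.2 hD)), one_smul]

/-- Small `m × n` matrices factor as `Aᵀ B` with small factors having `m` or `n` rows. -/
theorem exists_small_factorization {m n r : ℕ} (hr : r = m ∨ r = n) :
    ∃ (A : MatrixSpace m n → Matrix (Fin r) (Fin m) ℝ)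
      (B : MatrixSpace m n → Matrix (Fin r) (Fin n) ℝ),
      (∀ D, (A D).transpose * B D = D.toMatrix) ∧
        Tendsto A (𝓝 0) (𝓝 0) ∧ Tendsto B (𝓝 0) (𝓝 0) := by
  -- One factor is `√‖D‖` times the identity, the other `D / √‖D‖` up to transposition; both have
  -- size of order `√‖D‖`.
  rcases hr with rfl | rfl
  · refine ⟨fun D => √‖D‖ • 1, fun D => (√‖D‖)⁻¹ • D.toMatrix, fun D => ?_,
      tendsto_sqrt_norm_smul_one _ _ _, tendsto_inv_sqrt_norm_smul_toMatrix _ _⟩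
    simp only [Matrix.transpose_smul, Matrix.transpose_one, Matrix.smul_mul, Matrix.mul_smul,
      Matrix.one_mul, smul_smul]
    rw [mul_comm, sqrt_norm_mul_inv_smul_toMatrix]
  · refine ⟨fun D => ((√‖D‖)⁻¹ • D.toMatrix).transpose, fun D => √‖D‖ • 1, fun D => ?_, ?_,
      tendsto_sqrt_norm_smul_one _ _ _⟩
    · simp only [Matrix.transpose_transpose, Matrix.mul_smul, Matrix.mul_one, smul_smul]
      exact sqrt_norm_mul_inv_smul_toMatrix D
    · have := ((continuous_id.matrix_transpose (A := id)).tendsto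
        (0 : Matrix (Fin m) (Fin r) ℝ)).comp (tendsto_inv_sqrt_norm_smul_toMatrix m r)
      rwa [id, Matrix.transpose_zero] at this

namespace MatrixSpace

theorem toMatrix_ofMatrix {p q : ℕ} (A : Matrix (Fin p) (Fin q) ℝ) :
    (ofMatrix A).toMatrix = A := rfl

theorem ofMatrix_toMatrix {p q : ℕ} (A : MatrixSpace p q) : ofMatrix A.toMatrix = A := rfl

theorem toMatrix_sub {p q : ℕ} (A B : MatrixSpace p q) :
    (A - B).toMatrix = A.toMatrix - B.toMatrix := rfl

theorem continuous_ofMatrix {p q : ℕ} :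
    Continuous (ofMatrix : Matrix (Fin p) (Fin q) ℝ → MatrixSpace p q) := by
  unfold ofMatrix
  refine (PiLp.continuous_toLp 2 _).comp (continuous_pi fun ij => ?_)
  exact continuous_id.matrix_elem ij.1 ij.2

end MatrixSpace

/-- If `d` is large, the factorization map has a right inverse that is continuous at the image of
a given point `P` and maps it to `P`. -/
theorem exists_rightInverse_matrixFactorizationMap {d m n : ℕ} (hd : m + n + min m n ≤ d)
    (P : FactorSpace d m n) :
    ∃ φ : MatrixSpace m n → FactorSpace d m n, (∀ Z, matrixFactorizationMap d m n (φ Z) = Z) ∧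
      Tendsto φ (𝓝 (matrixFactorizationMap d m n P)) (𝓝 P) := by
  obtain ⟨A, B, hAB, hA, hB⟩ := exists_small_factorization (min_choice m n)
  obtain ⟨U, hU, hXU, hYU⟩ := exists_orthonormal_columns_orthogonal hd P.fst.toMatrix P.snd.toMatrix
  have hUY : U.transpose * P.snd.toMatrix = 0 := by
    simpa using congrArg Matrix.transpose hYU
  set Z₀ := matrixFactorizationMap d m n P with hZ₀
  refine ⟨fun Z => WithLp.toLp 2 (MatrixSpace.ofMatrix (P.fst.toMatrix + U * A (Z - Z₀)),
    MatrixSpace.ofMatrix (P.snd.toMatrix + U * B (Z - Z₀))), fun Z => ?_, ?_⟩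
  · have h1 : (P.fst.toMatrix + U * A (Z - Z₀)).transpose * (P.snd.toMatrix + U * B (Z - Z₀)) =
        Z.toMatrix := by
      rw [Matrix.transpose_add, Matrix.transpose_mul, Matrix.add_mul, Matrix.mul_add,
        Matrix.mul_add, ← Matrix.mul_assoc _ U, hXU, Matrix.mul_assoc _ U.transpose, hUY,
        Matrix.mul_assoc _ U.transpose, ← Matrix.mul_assoc U.transpose, hU, Matrix.one_mul, hAB,
        MatrixSpace.toMatrix_sub, hZ₀, matrixFactorizationMap, MatrixSpace.toMatrix_ofMatrix]
      simp
    exact congrArg MatrixSpace.ofMatrix h1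
  · have hsub : Tendsto (fun Z => Z - Z₀) (𝓝 Z₀) (𝓝 0) := by
      simpa using (continuous_sub_right Z₀).tendsto Z₀
    have hlim : ∀ {q : ℕ} (M : MatrixSpace d q) {C : MatrixSpace m n → Matrix (Fin (min m n)) (Fin q) ℝ},
        Tendsto C (𝓝 0) (𝓝 0) →
        Tendsto (fun Z => MatrixSpace.ofMatrix (M.toMatrix + U * C (Z - Z₀))) (𝓝 Z₀) (𝓝 M) := by
      intro q M C hC
      have hcont : Continuous fun N : Matrix (Fin (min m n)) (Fin q) ℝ =>
          MatrixSpace.ofMatrix (M.toMatrix + U * N) :=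
        MatrixSpace.continuous_ofMatrix.comp
          (continuous_const.add (continuous_const.matrix_mul continuous_id))
      have := (hcont.tendsto 0).comp (hC.comp hsub)
      rwa [Matrix.mul_zero, add_zero, MatrixSpace.ofMatrix_toMatrix] at this
    exact ((WithLp.prod_continuous_toLp 2 _ _).tendsto (P.fst, P.snd)).comp
      ((hlim P.fst hA).prodMk_nhds (hlim P.snd hB))

theorem mainTheorem2 (d m n : ℕ) (hd : m + n + min m n ≤ d)
    (ℓ : MatrixSpace m n → ℝ) (hℓ : LocallyLipschitz ℓ) (P : FactorSpace d m n) :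
    clarkeSubdifferential (fun Q : FactorSpace d m n => ℓ (matrixFactorizationMap d m n Q)) P =
      jacobianTranspose (matrixFactorizationMap d m n) P ''
        clarkeSubdifferential ℓ (matrixFactorizationMap d m n P) := by
  obtain ⟨φ, hφ, hlim⟩ := exists_rightInverse_matrixFactorizationMap hd P
  have hH := contDiff_matrixFactorizationMap d m n
  exact (clarkeSubdifferential_comp_subset hH hℓ P).antisymm
    (image_clarkeSubdifferential_subset hH ℓ hφ hlim)
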